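/- Consider Pólya's urn started with one red and one black ball: in each draw a ball is chosen uniformly at random from the urn and is put back together with $d=1$ further ball of the same colour. Let $R_n$ be the number of red balls in the urn after the $n$-th draw ($R_0=1$), let $Z_n=R_n/(n+2)$ be the proportion of red balls after the $n$-th draw, and let $S_{1,1}=\sup_{n\ge 0}Z_n$. For real $x>-1$ put $H(x)=\Psi(x+1)+\gamma$, where $\Psi=\Gamma'/\Gamma$ is the digamma function and $\gamma$ is Euler's constant. Then for every integer $t\ge 2$, $$\mathbb{P}\Big(S_{1,1}=\frac{t-1}{t}\Big)=\frac{2t-3}{t}\,H\Big(1-\frac1t\Big)-\frac{t-2}{t}\,H\Big(1-\frac2t\Big)-\frac{t-2}{t-1}$$ and $$\mathbb{P}\Big(S_{1,1}\le\frac{t-1}{t}\Big)=\Big(1-\frac1t\Big)H\Big(1-\frac1t\Big).$$ -/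

import Mathlib

open MeasureTheory ProbabilityTheory

namespace PolyaUrn

/-- Number of red balls in the urn after the first `n` draws, when the urn starts with `r` red
balls, `d` balls of the drawn colour are added after each draw, and `x i = true` means that the
`(i + 1)`-st draw is red. -/
def redBalls (r d : ℕ) (x : ℕ → Bool) (n : ℕ) : ℕ :=
  r + d * (Finset.filter (fun i => x i = true) (Finset.range n)).card

/-- Number of all balls in the urn after `n` draws, starting from `r` red and `b` black balls. -/
def totalBalls (r b d n : ℕ) : ℕ := n * d + r + b

/-- The proportion `Z n` of red balls after `n` draws. -/
noncomputable def redRatio (r b d : ℕ) (x : ℕ → Bool) (n : ℕ) : ℝ :=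
  (redBalls r d x n : ℝ) / (totalBalls r b d n : ℝ)

/-- The all-time supremum `sup_{n ≥ 0} Z n` of the proportion of red balls. All `Z n` lie
in `[0, 1]` (see `redRatio_le_one`), so this is a genuine supremum of real numbers. -/
noncomputable def supRatio (r b d : ℕ) (x : ℕ → Bool) : ℝ :=
  ⨆ n : ℕ, redRatio r b d x n

theorem redRatio_le_one (r b d : ℕ) (x : ℕ → Bool) (n : ℕ) : redRatio r b d x n ≤ 1 := by
  unfold redRatio
  apply div_le_one_of_le₀ _ (Nat.cast_nonneg _)
  have h : (Finset.filter (fun i => x i = true) (Finset.range n)).card ≤ n := by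
    simpa using Finset.card_filter_le (Finset.range n) (fun i => x i = true)
  have h2 := Nat.mul_le_mul_left d h
  unfold redBalls totalBalls
  exact_mod_cast (by rw [Nat.mul_comm n d]; omega)

/-- The event that the first `n` draws have the colours prescribed by `x`. -/
def drawsAgree {Ω : Type*} (X : ℕ → Ω → Bool) (x : ℕ → Bool) (n : ℕ) : Set Ω :=
  {ω | ∀ i < n, X i ω = x i}

/-- `X` is the sequence of draws (`true` for red, `false` for black) of a Pólya urn that starts
with `r` red and `b` black balls and receives `d` more balls of the drawn colour after each draw:
conditionally on any history of `n` draws (of positive probability), each ball in the urn is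
equally likely to be drawn next. -/
structure IsPolyaUrn {Ω : Type*} [MeasurableSpace Ω] (r b d : ℕ) (X : ℕ → Ω → Bool)
    (μ : Measure Ω) : Prop where
  measurable : ∀ n, Measurable (X n)
  prob_red : ∀ (n : ℕ) (x : ℕ → Bool), μ (drawsAgree X x n) ≠ 0 →
    (cond μ (drawsAgree X x n)).real {ω | X n ω = true} =
      (redBalls r d x n : ℝ) / (totalBalls r b d n : ℝ)

open Kernel in
/-- Pólya urns exist. -/
theorem exists_isPolyaUrn (r b d : ℕ) :
    ∃ (μ : Measure (ℕ → Bool)) (X : ℕ → (ℕ → Bool) → Bool),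
      IsProbabilityMeasure μ ∧ IsPolyaUrn r b d X μ := by
  classical
  -- coordinate `0` is a dummy, coordinate `i + 1` carries draw number `i + 1`
  let hist : (n : ℕ) → ((i : Finset.Iic n) → Bool) → ℕ → Bool :=
    fun n y i => if h : i + 1 ≤ n then y ⟨i + 1, by simpa using h⟩ else false
  let p : (n : ℕ) → ((i : Finset.Iic n) → Bool) → ENNReal := fun n y =>
    ENNReal.ofReal (redRatio r b d (hist n y) n)
  have hp : ∀ n y, p n y ≤ 1 := fun n y => by
    simpa [p] using redRatio_le_one r b d (hist n y) n
  let κ : (n : ℕ) → Kernel ((i : Finset.Iic n) → Bool) Bool := fun n =>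
    { toFun := fun y => p n y • Measure.dirac true + (1 - p n y) • Measure.dirac false
      measurable' := measurable_of_countable _ }
  have hκa : ∀ n y, κ n y = p n y • Measure.dirac true + (1 - p n y) • Measure.dirac false :=
    fun n y => rfl
  have : ∀ n, IsMarkovKernel (κ n) := fun n => ⟨fun y => ⟨by
    rw [hκa]; simp [add_tsub_cancel_of_le (hp n y)]⟩⟩
  let μ : Measure (ℕ → Bool) := trajMeasure (X := fun _ => Bool) (Measure.dirac false) κ
  have : IsProbabilityMeasure μ := by infer_instance
  refine ⟨μ, fun n ω => ω (n + 1), inferInstance, fun n => by fun_prop, fun n x hne => ?_⟩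
  have key := map_frestrictLe_trajMeasure_compProd_eq_map_trajMeasure
    (X := fun _ => Bool) (μ₀ := Measure.dirac false) (κ := κ) (a := n)
  change μ.map _ ⊗ₘ κ n = μ.map _ at key
  let A : Set ((i : Finset.Iic n) → Bool) := {y | ∀ i < n, hist n y i = x i}
  have hA : MeasurableSet A := (Set.toFinite A).measurableSet
  have hD : drawsAgree (fun n (ω : ℕ → Bool) => ω (n + 1)) x n
      = Preorder.frestrictLe n ⁻¹' A := by
    ext ω
    simp only [drawsAgree, A, Set.mem_ofPred_eq, Set.mem_preimage]
    refine forall_congr' fun i => forall_congr' fun hi => ?_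
    simp [hist, hi, Preorder.frestrictLe]
  have hDm : MeasurableSet (drawsAgree (fun n (ω : ℕ → Bool) => ω (n + 1)) x n) := by
    rw [hD]; exact (Preorder.measurable_frestrictLe n) hA
  have hpA : ∀ y ∈ A, κ n y {true} = ENNReal.ofReal (redRatio r b d x n) := by
    intro y hy
    rw [hκa]
    simp only [Measure.add_apply, Measure.smul_apply, MeasurableSet.singleton, Measure.dirac_apply']
    simp only [p, redRatio, redBalls]
    have : (Finset.range n).filter (fun i => hist n y i = true) =
        (Finset.range n).filter (fun i => x i = true) :=
      Finset.filter_congr fun i hi => by rw [hy i (Finset.mem_range.1 hi)]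
    rw [this]; simp
  have h1 := congrArg (fun ν => ν (A ×ˢ {true})) key
  rw [Measure.compProd_apply_prod hA (MeasurableSet.singleton _),
    setLIntegral_congr_fun hA hpA, MeasureTheory.setLIntegral_const,
    Measure.map_apply (by fun_prop) hA,
    Measure.map_apply (by fun_prop) (hA.prod (MeasurableSet.singleton _)), ← hD] at h1
  have h2 : (fun x : ℕ → Bool => (Preorder.frestrictLe (π := fun _ => Bool) n x, x (n + 1))) ⁻¹'
      (A ×ˢ {true}) = drawsAgree (fun n (ω : ℕ → Bool) => ω (n + 1)) x n ∩
        {ω | ω (n + 1) = true} := by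
    rw [hD]; ext ω; simp
  rw [h2] at h1
  rw [measureReal_def, cond_apply hDm, ← h1, mul_comm (ENNReal.ofReal _), ← mul_assoc,
    ENNReal.inv_mul_cancel hne (measure_ne_top _ _), one_mul, ENNReal.toReal_ofReal]
  · rfl
  · unfold redRatio; positivity

/-- The digamma function `Γ' / Γ` on the reals. -/
noncomputable def digamma (x : ℝ) : ℝ := deriv Real.Gamma x / Real.Gamma x

/-- The generalized harmonic number function `H x = Ψ (x + 1) + γ`. -/
noncomputable def H (x : ℝ) : ℝ := digamma (x + 1) + Real.eulerMascheroniConstant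

end PolyaUrn

namespace PolyaUrn

open Filter Topology

/-! Let `B n` be the number of black draws among the first `n`. Both `Z n ≤ q / (q + 1)` for all `n`
and its strict version say that the walk `c + (q + 1) * B n - n`, with steps `+q` (black) and `-1`
(red), never hits zero; the start `c` is `q` in the weak case and `q - 1` in the strict one
(`redRatio_le_iff`, `redRatio_lt_iff`).

The draws are exchangeable: a path of length `N` with `i` black draws has probability `(N - i)! i! /
(N + 1)!`. First passage to zero with `i` black draws takes `N = (q + 1) i + c` steps, and there are
`c / N * N.choose i` such paths. The factorials cancel, so the hitting time is `N` with probability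
`c / (N (N + 1))` (`measureReal_firstHit`). By partial fractions the sum over `i` is a difference of
two digamma values (`measureReal_hit`).

This gives the distribution function directly. For the atom, the strict event is subtracted from the
weak one. The only discrepancy is a supremum approached but never attained, which forces `Z n` to
converge to the threshold. The bounded martingale `Z n` converges almost surely, and its limit has
no atoms because each value of the number of red draws has probability at most `1 / (n + 1)`; so the
discrepancy is a null event (`measureReal_supRatio_eq`). -/

/-! ### The digamma function and its difference series. -/

lemma differentiableAt_Gamma_of_pos {x : ℝ} (hx : 0 < x) : DifferentiableAt ℝ Real.Gamma x :=
  Real.differentiableAt_Gamma fun m => by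
    have : (0 : ℝ) ≤ m := m.cast_nonneg
    linarith

lemma hasDerivAt_log_Gamma {x : ℝ} (hx : 0 < x) :
    HasDerivAt (Real.log ∘ Real.Gamma) (digamma x) x :=
  (differentiableAt_Gamma_of_pos hx).hasDerivAt.log (Real.Gamma_pos_of_pos hx).ne'

lemma log_Gamma_add_one {x : ℝ} (hx : 0 < x) :
    (Real.log ∘ Real.Gamma) (x + 1) = Real.log x + (Real.log ∘ Real.Gamma) x := by
  simp only [Function.comp_apply]
  rw [Real.Gamma_add_one hx.ne', Real.log_mul hx.ne' (Real.Gamma_pos_of_pos hx).ne']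

lemma digamma_add_one {x : ℝ} (hx : 0 < x) : digamma (x + 1) = digamma x + 1 / x := by
  have h1 : HasDerivAt (fun y => (Real.log ∘ Real.Gamma) (y + 1)) (digamma (x + 1)) x :=
    (hasDerivAt_log_Gamma (by linarith : 0 < x + 1)).comp_add_const x 1
  have h2 : HasDerivAt (fun y => Real.log y + (Real.log ∘ Real.Gamma) y) (x⁻¹ + digamma x) x :=
    (Real.hasDerivAt_log hx.ne').add (hasDerivAt_log_Gamma hx)
  have h3 := h2.congr_of_eventuallyEq (f₁ := fun y => (Real.log ∘ Real.Gamma) (y + 1))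
    ((lt_mem_nhds hx).mono fun y hy => log_Gamma_add_one hy)
  rw [h1.unique h3]
  ring

/-- By the functional equation the convex function `log Γ` has slope `log x` over `[x, x + 1]`. Its
derivative at the left endpoint is at most this slope; the next lemma uses the right endpoint. -/
lemma digamma_le_log {x : ℝ} (hx : 0 < x) : digamma x ≤ Real.log x := by
  have h := Real.convexOn_log_Gamma.deriv_le_slope (Set.mem_Ioi.2 hx)
    (Set.mem_Ioi.2 (by linarith : 0 < x + 1)) (by linarith)
    (hasDerivAt_log_Gamma hx).differentiableAt
  rw [(hasDerivAt_log_Gamma hx).deriv, slope_def_field, log_Gamma_add_one hx] at h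
  simpa using h

lemma log_le_digamma_add_one {x : ℝ} (hx : 0 < x) : Real.log x ≤ digamma (x + 1) := by
  have hx1 : 0 < x + 1 := by linarith
  have h := Real.convexOn_log_Gamma.slope_le_deriv (Set.mem_Ioi.2 hx)
    (Set.mem_Ioi.2 hx1) (by linarith)
    (hasDerivAt_log_Gamma hx1).differentiableAt
  rw [(hasDerivAt_log_Gamma hx1).deriv, slope_def_field, log_Gamma_add_one hx] at h
  simpa using h

lemma digamma_add_natCast {x : ℝ} (hx : 0 < x) (n : ℕ) :
    digamma (x + n) = digamma x + ∑ i ∈ Finset.range n, 1 / (x + i) := by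
  induction n with
  | zero => simp
  | succ n ih =>
    rw [Finset.sum_range_succ, ← add_assoc, ← ih, ← digamma_add_one (by positivity)]
    push_cast
    ring_nf

lemma tendsto_digamma_sub_log {x : ℝ} (hx : 0 < x) :
    Tendsto (fun n : ℕ => digamma (x + n) - Real.log n) atTop (𝓝 0) := by
  have hinv : Tendsto (fun n : ℕ => 1 / (x + n)) atTop (𝓝 0) :=
    tendsto_const_nhds.div_atTop
      (tendsto_atTop_add_const_left _ _ tendsto_natCast_atTop_atTop)
  have hlog : Tendsto (fun n : ℕ => Real.log (x + n) - Real.log n) atTop (𝓝 0) := by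
    have h : Tendsto (fun n : ℕ => Real.log (x / n + 1)) atTop (𝓝 (Real.log (0 + 1))) :=
      ((tendsto_const_div_atTop_nhds_zero_nat x).add_const 1).log (by norm_num)
    rw [zero_add, Real.log_one] at h
    refine h.congr' ?_
    filter_upwards [eventually_gt_atTop 0] with n hn
    have hn' : (0 : ℝ) < n := by exact_mod_cast hn
    rw [← Real.log_div (by positivity) hn'.ne', add_div, div_self hn'.ne']
  have hlow : Tendsto (fun n : ℕ => Real.log (x + n) - Real.log n - 1 / (x + n)) atTop (𝓝 0) := by
    simpa using hlog.sub hinv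
  refine tendsto_of_tendsto_of_tendsto_of_le_of_le hlow hlog (fun n => ?_) fun n => ?_
  · have hpos : 0 < x + n := by positivity
    have h1 := log_le_digamma_add_one hpos
    rw [digamma_add_one hpos] at h1
    dsimp only
    linarith
  · have hpos : 0 < x + n := by positivity
    have h1 := digamma_le_log hpos
    dsimp only
    linarith

/-- The recurrence writes each partial sum through `digamma (x + n)` and `digamma (y + n)`, whose
difference vanishes in the limit since both are asymptotic to `log n`. The assumption `x ≤ y` makes
the terms nonnegative, so convergence of partial sums suffices. -/
lemma hasSum_one_div_sub_one_div {x y : ℝ} (hx : 0 < x) (hxy : x ≤ y) :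
    HasSum (fun j : ℕ => 1 / (x + j) - 1 / (y + j)) (digamma y - digamma x) := by
  have hy : 0 < y := hx.trans_le hxy
  rw [hasSum_iff_tendsto_nat_of_nonneg]
  · have h := ((tendsto_digamma_sub_log hx).sub (tendsto_digamma_sub_log hy)).add_const
      (digamma y - digamma x)
    rw [sub_zero, zero_add] at h
    refine h.congr fun n => ?_
    rw [digamma_add_natCast hx, digamma_add_natCast hy, Finset.sum_sub_distrib]
    ring
  · intro j
    rw [sub_nonneg]
    gcongr

lemma digamma_one : digamma 1 = -Real.eulerMascheroniConstant := by
  rw [digamma, Real.eulerMascheroniConstant_eq_neg_deriv, Real.Gamma_one, div_one, neg_neg]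

lemma digamma_eq_H {x : ℝ} (hx : 0 < x) :
    digamma x = H x - Real.eulerMascheroniConstant - 1 / x := by
  rw [H, digamma_add_one hx]
  ring

/-! ### Counting red and black draws. -/

/-- Number of red draws among the first `n`. -/
def numRed (x : ℕ → Bool) (n : ℕ) : ℕ := Nat.count (fun i => x i = true) n

/-- Number of black draws among the first `n`. -/
def numBlack (x : ℕ → Bool) (n : ℕ) : ℕ := Nat.count (fun i => x i = false) n

@[simp] lemma numRed_zero (x : ℕ → Bool) : numRed x 0 = 0 := by simp [numRed]

@[simp] lemma numBlack_zero (x : ℕ → Bool) : numBlack x 0 = 0 := by simp [numBlack]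

lemma numRed_succ (x : ℕ → Bool) (n : ℕ) :
    numRed x (n + 1) = numRed x n + if x n = true then 1 else 0 := by
  simp [numRed, Nat.count_succ]

lemma numBlack_succ (x : ℕ → Bool) (n : ℕ) :
    numBlack x (n + 1) = numBlack x n + if x n = false then 1 else 0 := by
  simp [numBlack, Nat.count_succ]

lemma numRed_add_numBlack (x : ℕ → Bool) (n : ℕ) : numRed x n + numBlack x n = n := by
  induction n with
  | zero => simp
  | succ n ih =>
    rw [numRed_succ, numBlack_succ]
    cases h : x n <;> simp <;> omega

lemma numBlack_mono (x : ℕ → Bool) : Monotone (numBlack x) := Nat.count_monotone _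

lemma numRed_congr {x y : ℕ → Bool} {n : ℕ} (h : ∀ i < n, x i = y i) :
    numRed x n = numRed y n := by
  induction n with
  | zero => simp
  | succ n ih =>
    rw [numRed_succ, numRed_succ, ih fun i hi => h i (by omega), h n (by omega)]

lemma numBlack_congr {x y : ℕ → Bool} {n : ℕ} (h : ∀ i < n, x i = y i) :
    numBlack x n = numBlack y n := by
  induction n with
  | zero => simp
  | succ n ih =>
    rw [numBlack_succ, numBlack_succ, ih fun i hi => h i (by omega), h n (by omega)]

lemma redBalls_one_one (x : ℕ → Bool) (n : ℕ) : redBalls 1 1 x n = numRed x n + 1 := by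
  rw [redBalls, numRed, Nat.count_eq_card_filter_range]
  ring

lemma totalBalls_one_one_one (n : ℕ) : totalBalls 1 1 1 n = n + 2 := by
  rw [totalBalls]
  ring

lemma redRatio_one_one_one (x : ℕ → Bool) (n : ℕ) :
    redRatio 1 1 1 x n = ((numRed x n : ℝ) + 1) / (n + 2) := by
  rw [redRatio, redBalls_one_one, totalBalls_one_one_one]
  push_cast
  rfl

/-! ### The law of the first draws. -/

section Urn

variable {Ω : Type*} {X : ℕ → Ω → Bool}

lemma drawsAgree_succ (x : ℕ → Bool) (n : ℕ) :
    drawsAgree X x (n + 1) = drawsAgree X x n ∩ {ω | X n ω = x n} := by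
  ext ω
  simp only [drawsAgree, Set.mem_ofPred_eq, Set.mem_inter_iff, Nat.lt_succ_iff_lt_or_eq]
  exact ⟨fun h => ⟨fun i hi => h i (Or.inl hi), h n (Or.inr rfl)⟩,
    fun h i hi => hi.elim (h.1 i) fun e => e ▸ h.2⟩

lemma drawsAgree_congr {x y : ℕ → Bool} {n : ℕ} (h : ∀ i < n, x i = y i) :
    drawsAgree X x n = drawsAgree X y n := by
  ext ω
  exact forall_congr' fun i => forall_congr' fun hi => by rw [h i hi]

lemma drawsAgree_update_succ (x : ℕ → Bool) (n : ℕ) (b : Bool) :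
    drawsAgree X (Function.update x n b) (n + 1) = drawsAgree X x n ∩ {ω | X n ω = b} := by
  rw [drawsAgree_succ, Function.update_self,
    drawsAgree_congr fun i hi => Function.update_of_ne (by omega : i ≠ n) b x]

variable [MeasurableSpace Ω] {μ : Measure Ω}

lemma measurableSet_draw_eq (hm : ∀ n, Measurable (X n)) (n : ℕ) (b : Bool) :
    MeasurableSet {ω | X n ω = b} :=
  hm n (measurableSet_singleton b)

lemma measurableSet_drawsAgree (hm : ∀ n, Measurable (X n)) (x : ℕ → Bool) (n : ℕ) :
    MeasurableSet (drawsAgree X x n) := by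
  have h : drawsAgree X x n = ⋂ i ∈ Set.Iio n, {ω | X i ω = x i} := by
    ext ω
    simp [drawsAgree]
  rw [h]
  exact MeasurableSet.biInter (Set.to_countable _) fun i _ => measurableSet_draw_eq hm i _

lemma measurable_numBlack (hm : ∀ n, Measurable (X n)) (n : ℕ) :
    Measurable fun ω => numBlack (fun i => X i ω) n := by
  induction n with
  | zero => simp
  | succ n ih =>
    simp only [numBlack_succ]
    exact ih.add (Measurable.ite (measurableSet_draw_eq hm n false) measurable_const
      measurable_const)

variable [IsProbabilityMeasure μ]

lemma measureReal_drawsAgree_inter_red (hX : IsPolyaUrn 1 1 1 X μ) (x : ℕ → Bool) (n : ℕ) :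
    μ.real (drawsAgree X x n ∩ {ω | X n ω = true}) =
      μ.real (drawsAgree X x n) * ((numRed x n + 1) / (n + 2)) := by
  by_cases h0 : μ (drawsAgree X x n) = 0
  · have h1 : μ.real (drawsAgree X x n) = 0 := by simp [measureReal_def, h0]
    rw [h1, zero_mul]
    exact measureReal_mono_null Set.inter_subset_left h1
  · have h := hX.prob_red n x h0
    rw [measureReal_def, cond_apply (measurableSet_drawsAgree hX.measurable x n), ENNReal.toReal_mul,
      ENNReal.toReal_inv, ← measureReal_def, ← measureReal_def, redBalls_one_one,
      totalBalls_one_one_one] at h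
    have h1 : μ.real (drawsAgree X x n) ≠ 0 := by
      simpa [measureReal_def, ENNReal.toReal_eq_zero_iff] using h0
    push_cast at h
    rw [← h, mul_inv_cancel_left₀ h1]

lemma measureReal_drawsAgree_inter_black (hX : IsPolyaUrn 1 1 1 X μ) (x : ℕ → Bool) (n : ℕ) :
    μ.real (drawsAgree X x n ∩ {ω | X n ω = false}) =
      μ.real (drawsAgree X x n) * ((numBlack x n + 1) / (n + 2)) := by
  have h := measureReal_inter_add_sdiff (μ := μ) (s := drawsAgree X x n)
    (measurableSet_draw_eq hX.measurable n true)
  have h2 : drawsAgree X x n \ {ω | X n ω = true} = drawsAgree X x n ∩ {ω | X n ω = false} := by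
    ext ω
    simp
  have h3 : (numRed x n : ℝ) + numBlack x n = n := by exact_mod_cast numRed_add_numBlack x n
  rw [h2, measureReal_drawsAgree_inter_red hX] at h
  rw [eq_sub_of_add_eq' h, ← h3]
  field_simp
  ring

/-- The law of the first `n` draws. -/
lemma measureReal_drawsAgree (hX : IsPolyaUrn 1 1 1 X μ) (x : ℕ → Bool) (n : ℕ) :
    μ.real (drawsAgree X x n) =
      ((numRed x n).factorial * (numBlack x n).factorial : ℝ) / (n + 1).factorial := by
  induction n with
  | zero => simp [drawsAgree]
  | succ n ih =>
    rw [drawsAgree_succ, numRed_succ, numBlack_succ, Nat.factorial_succ (n + 1)]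
    have : ((n + 1).factorial : ℝ) ≠ 0 := by positivity
    cases x n
    · rw [measureReal_drawsAgree_inter_black hX, ih]
      simp only [Bool.false_eq_true, if_false, if_true, add_zero, Nat.factorial_succ (numBlack x n)]
      push_cast
      field_simp
      ring
    · rw [measureReal_drawsAgree_inter_red hX, ih]
      simp only [Bool.true_eq_false, if_false, if_true, add_zero, Nat.factorial_succ (numRed x n)]
      push_cast
      field_simp
      ring

end Urn

/-! ### First passage to zero. -/

/-- The draw sequences for which the walk starting at `c`, with steps `s` for black and `-1` for
red, hits zero for the first time after `n` draws. -/
def firstHit (s c n : ℕ) : Set (ℕ → Bool) :=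
  {x | (s + 1) * numBlack x n + c = n ∧ ∀ j < n, j < (s + 1) * numBlack x j + c}

/-- Number of first passage paths from height `k` to zero with `i` black draws. -/
noncomputable def firstPassageCount (s k i : ℕ) : ℝ :=
  if i = 0 then 1 else (k : ℝ) / ((s + 1) * i + k : ℕ) * (((s + 1) * i + k).choose i : ℝ)

lemma firstPassageCount_zero (s k : ℕ) : firstPassageCount s k 0 = 1 := if_pos rfl

lemma firstPassageCount_zero_succ (s i : ℕ) : firstPassageCount s 0 (i + 1) = 0 := by
  simp [firstPassageCount]

/-- The case `i = 0` is singled out in the definition only for `k = 0`, where the quotient `0 / 0`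
would give `0` instead of the one empty path. -/
lemma firstPassageCount_of_pos (s : ℕ) {k : ℕ} (hk : 0 < k) (i : ℕ) :
    firstPassageCount s k i =
      (k : ℝ) / ((s + 1) * i + k : ℕ) * (((s + 1) * i + k).choose i : ℝ) := by
  rcases Nat.eq_zero_or_pos i with rfl | hi
  · have : (k : ℝ) ≠ 0 := by positivity
    simp [firstPassageCount, this]
  · exact if_neg hi.ne'

/-- First-step decomposition: from height `k + 1` a red draw leads to `k`, a black draw to `k + s +
1` with one black draw fewer to come. -/
lemma firstPassageCount_succ_succ (s k i : ℕ) :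
    firstPassageCount s (k + 1) (i + 1) =
      firstPassageCount s k (i + 1) + firstPassageCount s (k + s + 1) i := by
  rw [firstPassageCount_of_pos s (Nat.succ_pos k), firstPassageCount_of_pos s (Nat.succ_pos (k + s)),
    firstPassageCount, if_neg (Nat.succ_ne_zero i)]
  obtain ⟨n, hn⟩ : ∃ n, n = (s + 1) * i + s + k := ⟨_, rfl⟩
  have e1 : (s + 1) * (i + 1) + (k + 1) = n + 2 := by rw [hn]; ring
  have e2 : (s + 1) * (i + 1) + k = n + 1 := by rw [hn]; ring
  have e3 : (s + 1) * i + (k + s + 1) = n + 1 := by rw [hn]; ring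
  rw [e1, e2, e3]
  have hni : i ≤ n := by rw [hn]; nlinarith [Nat.zero_le (s * i)]
  -- Absorption and Pascal's rule reduce all three binomials to `(n + 2).choose (i + 1)`, leaving a
  -- rational identity.
  have a1 : ((n + 2 : ℕ) : ℝ) * (n + 1).choose i = (n + 2).choose (i + 1) * (i + 1 : ℕ) := by
    exact_mod_cast Nat.add_one_mul_choose_eq (n + 1) i
  have a2 : ((n + 2).choose (i + 1) : ℝ) = (n + 1).choose i + (n + 1).choose (i + 1) := by
    exact_mod_cast Nat.choose_succ_succ (n + 1) i
  have hn' : (n : ℝ) = (s + 1) * i + s + k := by rw [hn]; push_cast; ring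
  have a3 : ((n + 1).choose (i + 1) : ℝ) = (n + 2).choose (i + 1) - (n + 1).choose i := by
    rw [a2]; ring
  rw [a3]
  push_cast at a1 ⊢
  have a4 : ((n + 1).choose i : ℝ) = (n + 2).choose (i + 1) * (i + 1) / (n + 2) := by
    rw [← a1]; field_simp
  rw [a4, hn']
  have p1 : ((s : ℝ) + 1) * i + s + k + 1 ≠ 0 := by positivity
  have p2 : ((s : ℝ) + 1) * i + s + k + 2 ≠ 0 := by positivity
  field_simp
  ring

section Hitting

variable {Ω : Type*} {X : ℕ → Ω → Bool} [MeasurableSpace Ω] {μ : Measure Ω}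
  [IsProbabilityMeasure μ]

/-- Generalization to an arbitrary history that makes induction possible: after `m` draws without a
hit the walk is at height `k`, and `n` further draws, `i` of them black, remain. The probability is
the number of continuations times the common probability of a full path. -/
lemma measureReal_drawsAgree_inter_firstHit (hX : IsPolyaUrn 1 1 1 X μ) (s c n : ℕ) :
    ∀ (m : ℕ) (x : ℕ → Bool) (k i : ℕ), (∀ j < m, j < (s + 1) * numBlack x j + c) →
      m + k = (s + 1) * numBlack x m + c → n = (s + 1) * i + k →
      μ.real (drawsAgree X x m ∩ {ω | (fun i => X i ω) ∈ firstHit s c (m + n)}) =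
        firstPassageCount s k i * ((numRed x m + s * i + k).factorial *
          (numBlack x m + i).factorial / (m + n + 1).factorial) := by
  induction n with
  | zero =>
    intro m x k i hx hk hn
    obtain rfl : k = 0 := by omega
    obtain rfl : i = 0 := by
      rcases Nat.mul_eq_zero.1 (show (s + 1) * i = 0 by omega) with h | h <;> omega
    have h : drawsAgree X x m ⊆ {ω | (fun i => X i ω) ∈ firstHit s c (m + 0)} := by
      intro ω hω
      refine ⟨?_, fun j hj => ?_⟩
      · rw [add_zero, numBlack_congr hω, ← hk, add_zero]
      · rw [numBlack_congr fun i hi => hω i (by omega)]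
        exact hx j hj
    rw [Set.inter_eq_left.2 h, measureReal_drawsAgree hX, firstPassageCount_zero]
    simp
  | succ n ih =>
    intro m x k i hx hk hn
    rcases k with _ | k
    -- At height zero the walk has already hit at time `m`, so a later time cannot be the first hit.
    · rcases i with _ | i
      · omega
      rw [firstPassageCount_zero_succ, zero_mul]
      convert measureReal_empty
      rw [Set.eq_empty_iff_forall_notMem]
      rintro ω ⟨h1, h2⟩
      have h3 := h2.2 m (by omega)
      rw [numBlack_congr h1] at h3
      omega
    · have hsplit := measureReal_inter_add_sdiff (μ := μ)
        (s := drawsAgree X x m ∩ {ω | (fun i => X i ω) ∈ firstHit s c (m + (n + 1))})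
        (measurableSet_draw_eq hX.measurable m true)
      have hT : drawsAgree X x m ∩ {ω | (fun i => X i ω) ∈ firstHit s c (m + (n + 1))} ∩
          {ω | X m ω = true} = drawsAgree X (Function.update x m true) (m + 1) ∩
            {ω | (fun i => X i ω) ∈ firstHit s c (m + 1 + n)} := by
        rw [drawsAgree_update_succ, Set.inter_right_comm, add_right_comm m 1 n, add_assoc]
      have hF : (drawsAgree X x m ∩ {ω | (fun i => X i ω) ∈ firstHit s c (m + (n + 1))}) \
          {ω | X m ω = true} = drawsAgree X (Function.update x m false) (m + 1) ∩
            {ω | (fun i => X i ω) ∈ firstHit s c (m + 1 + n)} := by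
        rw [drawsAgree_update_succ, Set.inter_right_comm, add_right_comm m 1 n, add_assoc]
        ext ω
        simp
      have hup : ∀ b j, j ≤ m → ∀ i < j, Function.update x m b i = x i :=
        fun b j hj i hi => Function.update_of_ne (by omega) _ _
      have hx' : ∀ b, ∀ j < m + 1,
          j < (s + 1) * numBlack (Function.update x m b) j + c := by
        intro b j hj
        rw [numBlack_congr (hup b j (by omega))]
        rcases Nat.lt_succ_iff_lt_or_eq.1 hj with h | rfl
        · exact hx j h
        · omega
      have hBT : numBlack (Function.update x m true) (m + 1) = numBlack x m := by
        rw [numBlack_succ, numBlack_congr (hup true m le_rfl)]; simp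
      have hRT : numRed (Function.update x m true) (m + 1) = numRed x m + 1 := by
        rw [numRed_succ, numRed_congr (hup true m le_rfl)]; simp
      have hBF : numBlack (Function.update x m false) (m + 1) = numBlack x m + 1 := by
        rw [numBlack_succ, numBlack_congr (hup false m le_rfl)]; simp
      have hRF : numRed (Function.update x m false) (m + 1) = numRed x m := by
        rw [numRed_succ, numRed_congr (hup false m le_rfl)]; simp
      rw [← hsplit, hT, hF, ih (m + 1) _ k i (hx' true) (by rw [hBT]; omega) (by omega),
        hBT, hRT]
      have e0 : m + (n + 1) + 1 = m + 1 + n + 1 := by ring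
      have e1 : numRed x m + 1 + s * i + k = numRed x m + s * i + (k + 1) := by ring
      rw [e0, e1]
      -- With no black draw left to spend, the branch in which the next draw is black is empty.
      rcases i with _ | i
      · have hempty : drawsAgree X (Function.update x m false) (m + 1) ∩
            {ω | (fun i => X i ω) ∈ firstHit s c (m + 1 + n)} = ∅ := by
          rw [Set.eq_empty_iff_forall_notMem]
          rintro ω ⟨h1, h2⟩
          have h3 := h2.1
          have h4 := numBlack_mono (fun i => X i ω) (show m + 1 ≤ m + 1 + n by omega)
          rw [numBlack_congr h1, hBF] at h4
          have h5 := Nat.mul_le_mul_left (s + 1) h4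
          rw [mul_add] at h5
          omega
        rw [hempty, measureReal_empty, firstPassageCount_zero, firstPassageCount_zero, add_zero]
      · have e2 : (s + 1) * (i + 1) = (s + 1) * i + s + 1 := by ring
        rw [ih (m + 1) _ (k + s + 1) i (hx' false) (by rw [hBF, mul_add]; omega) (by omega),
          hBF, hRF, firstPassageCount_succ_succ]
        have e3 : numRed x m + s * i + (k + s + 1) = numRed x m + s * (i + 1) + (k + 1) := by ring
        have e4 : numBlack x m + 1 + i = numBlack x m + (i + 1) := by ring
        rw [e3, e4]
        ring

lemma measureReal_firstHit (hX : IsPolyaUrn 1 1 1 X μ) (s : ℕ) {c : ℕ} (hc : 0 < c) (i : ℕ) :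
    μ.real {ω | (fun i => X i ω) ∈ firstHit s c ((s + 1) * i + c)} =
      c / (((s + 1) * i + c) * ((s + 1) * i + c + 1)) := by
  have h := measureReal_drawsAgree_inter_firstHit hX s c ((s + 1) * i + c) 0 (fun _ => true) c i
    (by omega) (by simp) rfl
  have h0 : drawsAgree X (fun _ => true) 0 = Set.univ := by simp [drawsAgree]
  rw [h0, Set.univ_inter, zero_add] at h
  rw [h, firstPassageCount_of_pos s hc]
  simp only [numRed_zero, numBlack_zero, zero_add]
  obtain ⟨N, hN⟩ : ∃ N, N = (s + 1) * i + c := ⟨_, rfl⟩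
  have hsub : s * i + c = N - i := by
    rw [hN, add_mul, one_mul]; omega
  have hiN : i ≤ N := by rw [hN, add_mul, one_mul]; omega
  have hN' : ((s : ℝ) + 1) * i + c = N := by rw [hN]; push_cast; ring
  have hN0 : (N : ℝ) ≠ 0 := by
    have : 0 < N := by omega
    positivity
  rw [hN', ← hN, hsub, Nat.choose_eq_factorial_div_factorial hiN,
    Nat.cast_div (Nat.factorial_mul_factorial_dvd_factorial hiN) (by positivity),
    Nat.factorial_succ]
  push_cast
  have := Nat.factorial_ne_zero
  field_simp

lemma measurableSet_firstHit (hm : ∀ n, Measurable (X n)) (s c n : ℕ) :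
    MeasurableSet {ω | (fun i => X i ω) ∈ firstHit s c n} := by
  have hset : ∀ (j : ℕ) (S : Set ℕ), MeasurableSet {ω | numBlack (fun i => X i ω) j ∈ S} :=
    fun j S => measurable_numBlack hm j (MeasurableSet.of_discrete)
  have h : {ω | (fun i => X i ω) ∈ firstHit s c n} =
      {ω | numBlack (fun i => X i ω) n ∈ {b | (s + 1) * b + c = n}} ∩
        ⋂ j ∈ Set.Iio n, {ω | numBlack (fun i => X i ω) j ∈ {b | j < (s + 1) * b + c}} := by
    ext ω
    simp [firstHit]
  rw [h]
  exact (hset _ _).inter (MeasurableSet.biInter (Set.to_countable _) fun j _ => hset _ _)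

/-- Downward steps have size one, so the walk cannot jump over zero: at the first time it is
nonpositive it equals zero. -/
lemma exists_mem_firstHit_iff (x : ℕ → Bool) (s c : ℕ) :
    (∃ i, x ∈ firstHit s c ((s + 1) * i + c)) ↔ ∃ n, (s + 1) * numBlack x n + c ≤ n := by
  constructor
  · rintro ⟨i, hi⟩
    exact ⟨_, hi.1.le⟩
  · intro h
    classical
    have hmin : ∀ j < Nat.find h, j < (s + 1) * numBlack x j + c :=
      fun j hj => not_le.1 (Nat.find_min h hj)
    have hle := Nat.find_spec h
    have heq : (s + 1) * numBlack x (Nat.find h) + c = Nat.find h := by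
      refine le_antisymm hle ?_
      rcases hz : Nat.find h with _ | n
      · exact Nat.zero_le _
      · have h1 := hmin n (by omega)
        have h2 := Nat.mul_le_mul_left (s + 1) (numBlack_mono x (Nat.le_succ n))
        simp only [Nat.succ_eq_add_one] at h2
        omega
    exact ⟨numBlack x (Nat.find h), by rw [heq]; exact ⟨heq, hmin⟩⟩

lemma firstHit_disjoint (s c : ℕ) {m n : ℕ} (h : m ≠ n) :
    Disjoint (firstHit s c m) (firstHit s c n) := by
  rw [Set.disjoint_left]
  intro x hm hn
  rcases lt_or_gt_of_ne h with h | h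
  · exact (hn.2 m h).ne' hm.1
  · exact (hm.2 n h).ne' hn.1

lemma hasSum_measureReal_hit (hX : IsPolyaUrn 1 1 1 X μ) (s : ℕ) {c : ℕ} (hc : 0 < c) :
    HasSum (fun i : ℕ => (c : ℝ) / (((s + 1) * i + c) * ((s + 1) * i + c + 1)))
      (μ.real {ω | ∃ n, (s + 1) * numBlack (fun i => X i ω) n + c ≤ n}) := by
  have hU : {ω | ∃ n, (s + 1) * numBlack (fun i => X i ω) n + c ≤ n} =
      ⋃ i : ℕ, {ω | (fun i => X i ω) ∈ firstHit s c ((s + 1) * i + c)} := by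
    ext ω
    simp [← exists_mem_firstHit_iff]
  have hd : Pairwise (Function.onFun Disjoint
      fun i : ℕ => {ω | (fun i => X i ω) ∈ firstHit s c ((s + 1) * i + c)}) := by
    intro i j hij
    have hne : (s + 1) * i + c ≠ (s + 1) * j + c := by
      simpa using hij
    exact (firstHit_disjoint s c hne).preimage (fun ω i => X i ω)
  have hsum := measure_iUnion (μ := μ) hd fun i => measurableSet_firstHit hX.measurable s c _
  rw [hU, measureReal_def, hsum, ENNReal.tsum_toReal_eq fun i => measure_ne_top _ _]
  simp_rw [← measureReal_firstHit hX s hc]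
  exact ENNReal.hasSum_toReal (by rw [← hsum]; exact measure_ne_top _ _)

/-- The probability that the walk started at `c` hits zero. -/
lemma measureReal_hit (hX : IsPolyaUrn 1 1 1 X μ) (s : ℕ) {c : ℕ} (hc : 0 < c) :
    μ.real {ω | ∃ n, (s + 1) * numBlack (fun i => X i ω) n + c ≤ n} =
      c / (s + 1) * (digamma ((c + 1) / (s + 1)) - digamma (c / (s + 1))) := by
  have hc' : (0 : ℝ) < c := by positivity
  have h := (hasSum_one_div_sub_one_div (x := (c : ℝ) / (s + 1)) (y := ((c : ℝ) + 1) / (s + 1))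
    (by positivity) (by gcongr; linarith)).mul_left ((c : ℝ) / (s + 1))
  -- Partial fractions `c / (N (N + 1)) = c / N - c / (N + 1)` with `N = (s + 1) j + c`, rescaled by
  -- `s + 1`.
  have key : ∀ j : ℕ, (c : ℝ) / (s + 1) * (1 / (c / (s + 1) + j) - 1 / ((c + 1) / (s + 1) + j)) =
      c / (((s + 1) * j + c) * ((s + 1) * j + c + 1)) := by
    intro j
    have e1 : (c : ℝ) / (s + 1) + j = ((s + 1) * j + c) / (s + 1) := by field_simp; ring
    have e2 : ((c : ℝ) + 1) / (s + 1) + j = ((s + 1) * j + c + 1) / (s + 1) := by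
      field_simp
      ring
    rw [e1, e2]
    field_simp
    ring
  simp only [key] at h
  exact (hasSum_measureReal_hit hX s hc).unique h

end Hitting

/-! ### Almost sure convergence of the proportion, and absence of atoms in its limit. -/

section Convergence

variable {Ω : Type*} {X : ℕ → Ω → Bool} [mΩ : MeasurableSpace Ω] {μ : Measure Ω}

/-- The filtration generated by the draws; its `n`-th member knows the first `n` draws. -/
def drawFiltration (hm : ∀ n, Measurable (X n)) : Filtration ℕ mΩ where
  seq n := MeasurableSpace.comap (fun ω (i : Fin n) => X i ω) inferInstance
  mono' m n hmn := by
    refine MeasurableSpace.comap_le_iff_le_map.2 ?_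
    intro T hT
    refine ⟨(fun y (i : Fin m) => y (Fin.castLE hmn i)) ⁻¹' T, ?_, rfl⟩
    exact MeasurableSet.of_discrete
  le' n := Measurable.comap_le (measurable_pi_lambda _ fun i => hm i)

lemma numRed_measurable_drawFiltration (hm : ∀ n, Measurable (X n)) (n : ℕ) :
    Measurable[drawFiltration hm n] fun ω => numRed (fun i => X i ω) n := by
  intro T _
  refine ⟨{y | numRed (fun i => if h : i < n then y ⟨i, h⟩ else false) n ∈ T},
    MeasurableSet.of_discrete, ?_⟩
  ext ω
  simp only [Set.mem_preimage, Set.mem_ofPred_eq]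
  rw [numRed_congr (n := n) (y := fun i => X i ω) fun i hi => dif_pos hi]

/-- Integrals over events of the first `n` draws are determined by those over the elementary
events. -/
lemma setIntegral_eq_of_drawsAgree (hm : ∀ n, Measurable (X n)) (n : ℕ) {f g : Ω → ℝ}
    (hf : Integrable f μ) (hg : Integrable g μ)
    (h : ∀ x, ∫ ω in drawsAgree X x n, f ω ∂μ = ∫ ω in drawsAgree X x n, g ω ∂μ)
    {s : Set Ω} (hs : MeasurableSet[drawFiltration hm n] s) :
    ∫ ω in s, f ω ∂μ = ∫ ω in s, g ω ∂μ := by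
  classical
  obtain ⟨T, -, rfl⟩ := hs
  let D : (Fin n → Bool) → Set Ω :=
    fun y => drawsAgree X (fun i => if h : i < n then y ⟨i, h⟩ else false) n
  have hD : ∀ y, D y = {ω | (fun i : Fin n => X i ω) = y} := by
    intro y
    ext ω
    simp only [D, drawsAgree, Set.mem_ofPred_eq, funext_iff]
    exact ⟨fun h i => by simpa using h i i.2, fun h i hi => by simpa [hi] using h ⟨i, hi⟩⟩
  have hU : (fun ω (i : Fin n) => X i ω) ⁻¹' T = ⋃ y ∈ T.toFinset, D y := by
    ext ω
    simp [hD]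
  have hmeas : ∀ y ∈ T.toFinset, MeasurableSet (D y) :=
    fun y _ => measurableSet_drawsAgree hm _ n
  have hdisj : (T.toFinset : Set (Fin n → Bool)).Pairwise (Function.onFun Disjoint D) := by
    intro y _ z _ hyz
    simp only [Function.onFun, hD]
    rw [Set.disjoint_left]
    intro ω h1 h2
    exact hyz (h1.symm.trans h2)
  rw [hU, integral_biUnion_finset _ hmeas hdisj fun y _ => hf.integrableOn,
    integral_biUnion_finset _ hmeas hdisj fun y _ => hg.integrableOn]
  exact Finset.sum_congr rfl fun y _ => h _

lemma redRatio_nonneg (r b d : ℕ) (x : ℕ → Bool) (n : ℕ) : 0 ≤ redRatio r b d x n := by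
  unfold redRatio
  positivity

lemma measurable_redRatio (hm : ∀ n, Measurable (X n)) (n : ℕ) :
    Measurable[drawFiltration hm n] fun ω => redRatio 1 1 1 (fun i => X i ω) n := by
  simp only [redRatio_one_one_one]
  exact (Measurable.of_discrete (f := fun k : ℕ => ((k : ℝ) + 1) / (n + 2))).comp
    (numRed_measurable_drawFiltration hm n)

lemma integrable_redRatio [IsFiniteMeasure μ] (hm : ∀ n, Measurable (X n)) (n : ℕ) :
    Integrable (fun ω => redRatio 1 1 1 (fun i => X i ω) n) μ := by
  refine Integrable.of_bound
    ((measurable_redRatio hm n).mono ((drawFiltration hm).le n) le_rfl).aestronglyMeasurable 1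
    (ae_of_all _ fun ω => ?_)
  rw [Real.norm_of_nonneg (redRatio_nonneg ..)]
  exact redRatio_le_one ..

lemma setIntegral_drawsAgree_redRatio (hm : ∀ n, Measurable (X n)) (x : ℕ → Bool) (n : ℕ) :
    ∫ ω in drawsAgree X x n, redRatio 1 1 1 (fun i => X i ω) n ∂μ =
      μ.real (drawsAgree X x n) * ((numRed x n + 1) / (n + 2)) := by
  rw [setIntegral_congr_fun (g := fun _ => ((numRed x n : ℝ) + 1) / (n + 2))
    (measurableSet_drawsAgree hm x n) fun ω hω => ?_, setIntegral_const, smul_eq_mul]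
  dsimp only
  rw [redRatio_one_one_one, numRed_congr hω]

variable [IsProbabilityMeasure μ]

lemma martingale_redRatio (hX : IsPolyaUrn 1 1 1 X μ) :
    Martingale (fun n ω => redRatio 1 1 1 (fun i => X i ω) n) (drawFiltration hX.measurable) μ := by
  refine martingale_of_setIntegral_eq_succ
    (fun n => (measurable_redRatio hX.measurable n).stronglyMeasurable)
    (integrable_redRatio hX.measurable) fun n s hs => ?_
  -- The martingale identity is checked on each elementary event, split by the colour of the next
  -- draw.
  refine setIntegral_eq_of_drawsAgree hX.measurable n (integrable_redRatio hX.measurable n)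
    (integrable_redRatio hX.measurable (n + 1)) (fun x => ?_) hs
  have hsplit := integral_inter_add_sdiff (s := drawsAgree X x n) (μ := μ)
    (f := fun ω => redRatio 1 1 1 (fun i => X i ω) (n + 1))
    (measurableSet_draw_eq hX.measurable n true) (integrable_redRatio hX.measurable _).integrableOn
  have hdiff : drawsAgree X x n \ {ω | X n ω = true} = drawsAgree X x n ∩ {ω | X n ω = false} := by
    ext ω
    simp
  have hcongr : ∀ b, numRed (Function.update x n b) n = numRed x n :=
    fun b => numRed_congr fun i hi => Function.update_of_ne hi.ne _ _
  rw [← hsplit, hdiff, ← drawsAgree_update_succ, ← drawsAgree_update_succ,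
    setIntegral_drawsAgree_redRatio hX.measurable, setIntegral_drawsAgree_redRatio hX.measurable,
    setIntegral_drawsAgree_redRatio hX.measurable, drawsAgree_update_succ, drawsAgree_update_succ,
    measureReal_drawsAgree_inter_red hX, measureReal_drawsAgree_inter_black hX, numRed_succ,
    numRed_succ, hcongr, hcongr, Function.update_self, Function.update_self]
  have h3 : (numBlack x n : ℝ) = n - numRed x n := by
    rw [eq_sub_iff_add_eq']
    exact_mod_cast numRed_add_numBlack x n
  rw [h3]
  push_cast
  simp only [if_true]
  field_simp
  ring

lemma ae_exists_tendsto_redRatio (hX : IsPolyaUrn 1 1 1 X μ) :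
    ∀ᵐ ω ∂μ, ∃ L, Tendsto (fun n => redRatio 1 1 1 (fun i => X i ω) n) atTop (𝓝 L) := by
  refine (martingale_redRatio hX).submartingale.exists_ae_tendsto_of_bdd (R := 1) fun n => ?_
  refine (eLpNorm_le_of_ae_bound (C := 1) (ae_of_all _ fun ω => ?_)).trans (by simp)
  rw [Real.norm_of_nonneg (redRatio_nonneg ..)]
  exact redRatio_le_one ..

/-- The conditional probability of red given the first `n` draws depends only on the number of red
draws, so the history may be coarsened to that number. -/
lemma measureReal_numRed_eq_inter_red (hX : IsPolyaUrn 1 1 1 X μ) (n r : ℕ) :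
    μ.real ({ω | numRed (fun i => X i ω) n = r} ∩ {ω | X n ω = true}) =
      μ.real {ω | numRed (fun i => X i ω) n = r} * ((r + 1) / (n + 2)) := by
  have hs : MeasurableSet[drawFiltration hX.measurable n]
      {ω | numRed (fun i => X i ω) n = r} :=
    numRed_measurable_drawFiltration hX.measurable n (measurableSet_singleton r)
  have hred := measurableSet_draw_eq hX.measurable n true
  have h := setIntegral_eq_of_drawsAgree (μ := μ) hX.measurable n
    (integrable_redRatio hX.measurable n)
    (((integrable_const (1 : ℝ))).indicator hred)
    (fun x => by
      rw [setIntegral_drawsAgree_redRatio hX.measurable, setIntegral_indicator hred,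
        setIntegral_const, smul_eq_mul, mul_one, measureReal_drawsAgree_inter_red hX]) hs
  rw [setIntegral_indicator hred, setIntegral_const, smul_eq_mul, mul_one] at h
  rw [← h, setIntegral_congr_fun (g := fun _ => ((r : ℝ) + 1) / (n + 2))
    ((drawFiltration hX.measurable).le n _ hs) fun ω hω => ?_, setIntegral_const, smul_eq_mul]
  dsimp only
  rw [redRatio_one_one_one, show numRed (fun i => X i ω) n = r from hω]

lemma measureReal_numRed_eq_inter_black (hX : IsPolyaUrn 1 1 1 X μ) (n r : ℕ) :
    μ.real ({ω | numRed (fun i => X i ω) n = r} ∩ {ω | X n ω = false}) =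
      μ.real {ω | numRed (fun i => X i ω) n = r} * ((n + 1 - r) / (n + 2)) := by
  have h := measureReal_inter_add_sdiff (μ := μ) (s := {ω | numRed (fun i => X i ω) n = r})
    (measurableSet_draw_eq hX.measurable n true)
  have h2 : {ω | numRed (fun i => X i ω) n = r} \ {ω | X n ω = true} =
      {ω | numRed (fun i => X i ω) n = r} ∩ {ω | X n ω = false} := by
    ext ω
    simp
  rw [h2, measureReal_numRed_eq_inter_red hX] at h
  rw [eq_sub_of_add_eq' h]
  field_simp
  ring

/-- The number of red draws is at most uniformly distributed on `{0, …, n}`. -/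
lemma measureReal_numRed_eq_le (hX : IsPolyaUrn 1 1 1 X μ) (n r : ℕ) :
    μ.real {ω | numRed (fun i => X i ω) n = r} ≤ 1 / (n + 1) := by
  induction n generalizing r with
  | zero => simp
  | succ n ih =>
    have hsplit := measureReal_inter_add_sdiff (μ := μ)
      (s := {ω | numRed (fun i => X i ω) (n + 1) = r}) (measurableSet_draw_eq hX.measurable n true)
    have hF : {ω | numRed (fun i => X i ω) (n + 1) = r} \ {ω | X n ω = true} =
        {ω | numRed (fun i => X i ω) n = r} ∩ {ω | X n ω = false} := by
      ext ω
      cases h : X n ω <;> simp [numRed_succ, h]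
    rw [hF, measureReal_numRed_eq_inter_black hX] at hsplit
    rcases r with _ | r
    · have hT : {ω | numRed (fun i => X i ω) (n + 1) = 0} ∩ {ω | X n ω = true} = ∅ := by
        ext ω
        cases h : X n ω <;> simp [numRed_succ, h]
      rw [hT, measureReal_empty, zero_add] at hsplit
      rw [← hsplit]
      calc _ ≤ 1 / ((n : ℝ) + 1) * ((n + 1 - (0 : ℕ)) / (n + 2)) := by
            gcongr
            · simp; positivity
            · exact ih 0
        _ = 1 / ((n + 1 : ℕ) + 1) := by push_cast; field_simp; ring
    -- For `r > n` the weight `n - r` in the recursion would be negative; the event is then empty.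
    · by_cases hr : r ≤ n
      · have hT : {ω | numRed (fun i => X i ω) (n + 1) = r + 1} ∩ {ω | X n ω = true} =
            {ω | numRed (fun i => X i ω) n = r} ∩ {ω | X n ω = true} := by
          ext ω
          cases h : X n ω <;> simp [numRed_succ, h]
        rw [hT, measureReal_numRed_eq_inter_red hX] at hsplit
        have hr' : (r : ℝ) ≤ n := by exact_mod_cast hr
        rw [← hsplit]
        calc _ ≤ 1 / ((n : ℝ) + 1) * ((r + 1) / (n + 2)) +
              1 / ((n : ℝ) + 1) * ((n + 1 - (r + 1 : ℕ)) / (n + 2)) := by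
              gcongr
              · exact ih r
              · push_cast
                apply div_nonneg _ (by positivity)
                linarith
              · exact ih (r + 1)
          _ = 1 / ((n + 1 : ℕ) + 1) := by push_cast; field_simp; ring
      · have hempty : {ω | numRed (fun i => X i ω) (n + 1) = r + 1} = ∅ := by
          rw [Set.eq_empty_iff_forall_notMem]
          intro ω hω
          have h1 : numRed (fun i => X i ω) (n + 1) = r + 1 := hω
          have h2 := numRed_add_numBlack (fun i => X i ω) (n + 1)
          omega
        rw [hempty, measureReal_empty]
        positivity

/-- The window confines the number of red draws to an interval of length `2 * δ * (n + 2)`, hence to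
at most one more than that many integers, each of probability at most `1 / (n + 1)`. -/
lemma measureReal_abs_redRatio_sub_lt (hX : IsPolyaUrn 1 1 1 X μ) (n : ℕ) (c : ℝ) {δ : ℝ}
    (hδ : 0 < δ) :
    μ.real {ω | |redRatio 1 1 1 (fun i => X i ω) n - c| < δ} ≤
      2 * δ + (2 * δ + 1) * (1 / (n + 1)) := by
  have hn : (0 : ℝ) < n + 2 := by positivity
  set u : ℝ := (c - δ) * (n + 2) - 1 with hu
  set v : ℝ := (c + δ) * (n + 2) - 1 with hv
  have hsub : {ω | |redRatio 1 1 1 (fun i => X i ω) n - c| < δ} ⊆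
      ⋃ z ∈ Finset.Icc ⌈u⌉ ⌊v⌋, {ω | numRed (fun i => X i ω) n = z.toNat} := by
    intro ω hω
    rw [Set.mem_ofPred_eq, redRatio_one_one_one, abs_lt, neg_lt_sub_iff_lt_add, sub_lt_iff_lt_add,
      div_lt_iff₀ hn, ← sub_lt_iff_lt_add', lt_div_iff₀ hn] at hω
    simp only [Set.mem_iUnion, Set.mem_ofPred_eq]
    refine ⟨(numRed (fun i => X i ω) n : ℤ), ?_, (Int.toNat_natCast _).symm⟩
    rw [Finset.mem_Icc, Int.ceil_le, Int.le_floor]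
    push_cast
    rw [hu, hv]
    constructor <;> linarith [hω.1, hω.2]
  have hcard : ((Finset.Icc ⌈u⌉ ⌊v⌋).card : ℝ) ≤ 2 * δ * (n + 2) + 1 := by
    rw [Int.card_Icc]
    have h1 : (((⌊v⌋ + 1 - ⌈u⌉).toNat : ℤ) : ℝ) ≤ 2 * δ * (n + 2) + 1 := by
      rw [Int.toNat_eq_max]
      push_cast
      refine max_le ?_ (by positivity)
      have h2 := Int.floor_le v
      have h3 := Int.le_ceil u
      have h4 : v - u = 2 * δ * (n + 2) := by rw [hu, hv]; ring
      linarith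
    exact_mod_cast h1
  calc _ ≤ μ.real (⋃ z ∈ Finset.Icc ⌈u⌉ ⌊v⌋, {ω | numRed (fun i => X i ω) n = z.toNat}) :=
        measureReal_mono hsub (measure_ne_top _ _)
    _ ≤ ∑ z ∈ Finset.Icc ⌈u⌉ ⌊v⌋, μ.real {ω | numRed (fun i => X i ω) n = z.toNat} :=
        measureReal_biUnion_finset_le _ _
    _ ≤ (Finset.Icc ⌈u⌉ ⌊v⌋).card • (1 / ((n : ℝ) + 1)) :=
        Finset.sum_le_card_nsmul _ _ _ fun z _ => measureReal_numRed_eq_le hX n _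
    _ ≤ (2 * δ * (n + 2) + 1) * (1 / ((n : ℝ) + 1)) := by
        rw [nsmul_eq_mul]
        gcongr
    _ = 2 * δ + (2 * δ + 1) * (1 / (n + 1)) := by
        field_simp
        ring

/-- The limiting proportion of red balls has no atoms. -/
lemma ae_not_tendsto_redRatio (hX : IsPolyaUrn 1 1 1 X μ) (c : ℝ) :
    ∀ᵐ ω ∂μ, ¬ Tendsto (fun n => redRatio 1 1 1 (fun i => X i ω) n) atTop (𝓝 c) := by
  rw [ae_iff]
  simp only [not_not]
  suffices h : ∀ ε > 0, μ.real
      {ω | Tendsto (fun n => redRatio 1 1 1 (fun i => X i ω) n) atTop (𝓝 c)} ≤ ε by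
    rw [← measureReal_eq_zero_iff]
    exact le_antisymm (le_of_forall_pos_le_add fun ε hε => by simpa using h ε hε)
      measureReal_nonneg
  intro ε hε
  -- Convergence to `c` puts `ω` in some `A M`. These events increase, and each lies in the `ε /
  -- 2`-window at every time `n ≥ M`, whose probability bound tends to `ε`.
  let A : ℕ → Set Ω := fun M => {ω | ∀ n ≥ M, |redRatio 1 1 1 (fun i => X i ω) n - c| < ε / 2}
  have hA : Monotone A := fun M N hMN ω hω n hn => hω n (hMN.trans hn)
  have hbound : ∀ M, μ (A M) ≤ ENNReal.ofReal ε := by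
    intro M
    rw [← ofReal_measureReal]
    refine ENNReal.ofReal_le_ofReal ?_
    have hlim : Tendsto (fun n : ℕ => 2 * (ε / 2) + (2 * (ε / 2) + 1) * (1 / ((n : ℝ) + 1))) atTop
        (𝓝 (2 * (ε / 2) + (2 * (ε / 2) + 1) * 0)) :=
      (tendsto_one_div_add_atTop_nhds_zero_nat.const_mul _).const_add _
    rw [mul_zero, add_zero, mul_div_cancel₀ ε two_ne_zero] at hlim
    refine ge_of_tendsto hlim ?_
    filter_upwards [eventually_ge_atTop M] with n hn
    have h1 := measureReal_abs_redRatio_sub_lt hX n c (half_pos hε)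
    rw [mul_div_cancel₀ ε two_ne_zero] at h1
    have hsub : A M ⊆ {ω | |redRatio 1 1 1 (fun i => X i ω) n - c| < ε / 2} :=
      fun ω hω => hω n hn
    exact (measureReal_mono hsub (measure_ne_top _ _)).trans h1
  have hU : {ω | Tendsto (fun n => redRatio 1 1 1 (fun i => X i ω) n) atTop (𝓝 c)} ⊆
      ⋃ M, A M := by
    intro ω hω
    obtain ⟨M, hM⟩ := Metric.tendsto_atTop.1 hω (ε / 2) (half_pos hε)
    exact Set.mem_iUnion.2 ⟨M, fun n hn => by simpa [Real.dist_eq] using hM n hn⟩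
  refine ENNReal.toReal_le_of_le_ofReal hε.le ((measure_mono hU).trans ?_)
  rw [hA.measure_iUnion]
  exact iSup_le hbound

end Convergence

/-! ### From the supremum to the walk. -/

lemma bddAbove_range_redRatio (r b d : ℕ) (x : ℕ → Bool) :
    BddAbove (Set.range (redRatio r b d x)) :=
  ⟨1, by rintro _ ⟨n, rfl⟩; exact redRatio_le_one r b d x n⟩

lemma supRatio_le_iff (r b d : ℕ) (x : ℕ → Bool) (c : ℝ) :
    supRatio r b d x ≤ c ↔ ∀ n, redRatio r b d x n ≤ c :=
  ciSup_le_iff (bddAbove_range_redRatio r b d x)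

/-- If the proportions stay below `c` and have a limit below `c`, so does their supremum. -/
lemma supRatio_lt_of_tendsto {r b d : ℕ} {x : ℕ → Bool} {c L : ℝ}
    (h : ∀ n, redRatio r b d x n < c) (hL : Tendsto (redRatio r b d x) atTop (𝓝 L)) (hLc : L < c) :
    supRatio r b d x < c := by
  -- From time `N` on the proportions stay below `m < c`; the finitely many earlier ones have a
  -- maximum below `c`.
  obtain ⟨m, hLm, hmc⟩ := exists_between hLc
  obtain ⟨N, hN⟩ := eventually_atTop.1 (hL.eventually (gt_mem_nhds hLm))
  set M := (Finset.range (N + 1)).sup' Finset.nonempty_range_add_one (redRatio r b d x)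
  have hM : M < c := (Finset.sup'_lt_iff _).2 fun n _ => h n
  refine lt_of_le_of_lt ((supRatio_le_iff ..).2 fun n => ?_) (max_lt hmc hM)
  rcases le_or_gt N n with hn | hn
  · exact (hN n hn).le.trans (le_max_left _ _)
  · exact (Finset.le_sup' (redRatio r b d x) (Finset.mem_range.2 (by omega))).trans
      (le_max_right _ _)

lemma redRatio_le_iff (x : ℕ → Bool) (s n : ℕ) :
    redRatio 1 1 1 x n ≤ (s : ℝ) / (s + 1) ↔ n < (s + 1) * numBlack x n + s := by
  rw [redRatio_one_one_one, div_le_div_iff₀ (by positivity) (by positivity)]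
  have h : (n : ℝ) = numRed x n + numBlack x n := by exact_mod_cast (numRed_add_numBlack x n).symm
  have h' : n < (s + 1) * numBlack x n + s ↔
      (numRed x n + numBlack x n : ℝ) + 1 ≤ (s + 1) * numBlack x n + s := by
    rw [← h]
    exact_mod_cast Nat.lt_iff_add_one_le
  rw [h', h]
  constructor <;> intro h <;> linarith

/-- With `q = s + 1` the inequality reads `numRed + 1 < q * (numBlack + 1)`; strictness over the
integers lowers the starting height from `q` to `q - 1 = s`. -/
lemma redRatio_lt_iff (x : ℕ → Bool) (s n : ℕ) :
    redRatio 1 1 1 x n < ((s + 1 : ℕ) : ℝ) / ((s + 1 : ℕ) + 1) ↔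
      n < (s + 1 + 1) * numBlack x n + s := by
  rw [redRatio_one_one_one, div_lt_div_iff₀ (by positivity) (by positivity)]
  have h : (n : ℝ) = numRed x n + numBlack x n := by exact_mod_cast (numRed_add_numBlack x n).symm
  have h' : n < (s + 1 + 1) * numBlack x n + s ↔
      (numRed x n + numBlack x n : ℝ) < (s + 1 + 1) * numBlack x n + s := by
    rw [← h]
    exact_mod_cast Iff.rfl
  rw [h', h]
  push_cast
  constructor <;> intro h <;> linarith

/-! ### Evaluation of the probabilities. -/

section Main

variable {Ω : Type*} {X : ℕ → Ω → Bool} [MeasurableSpace Ω] {μ : Measure Ω}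
  [IsProbabilityMeasure μ]

lemma measurableSet_forall_lt (hm : ∀ n, Measurable (X n)) (s c : ℕ) :
    MeasurableSet {ω | ∀ n, n < s * numBlack (fun i => X i ω) n + c} := by
  rw [Set.ofPred_forall]
  exact MeasurableSet.iInter fun n => measurable_numBlack hm n
    (MeasurableSet.of_discrete (s := {b | n < s * b + c}))

lemma measureReal_forall_lt (hX : IsPolyaUrn 1 1 1 X μ) (s : ℕ) {c : ℕ} (hc : 0 < c) :
    μ.real {ω | ∀ n, n < (s + 1) * numBlack (fun i => X i ω) n + c} =
      1 - c / (s + 1) * (digamma ((c + 1) / (s + 1)) - digamma (c / (s + 1))) := by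
  rw [← measureReal_hit hX s hc, eq_sub_iff_add_eq',
    ← probReal_add_probReal_compl (μ := μ) (measurableSet_forall_lt hX.measurable (s + 1) c), add_comm]
  congr 2
  ext ω
  simp

lemma measureReal_supRatio_le (hX : IsPolyaUrn 1 1 1 X μ) {s : ℕ} (hs : 0 < s) :
    μ.real {ω | supRatio 1 1 1 (fun n => X n ω) ≤ (s : ℝ) / (s + 1)} =
      (s : ℝ) / (s + 1) * H (s / (s + 1)) := by
  simp only [supRatio_le_iff, redRatio_le_iff]
  have hs' : (0 : ℝ) < s := by exact_mod_cast hs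
  -- The start `c = s` makes the first digamma argument `(s + 1) / (s + 1) = 1`, which contributes
  -- `-γ`.
  rw [measureReal_forall_lt hX s hs, div_self (by positivity), digamma_one,
    digamma_eq_H (by positivity)]
  field_simp
  ring

/-- Almost surely the supremum equals `c` exactly when it is at most `c` and some proportion reaches
`c`: if all stay strictly below, so does the limit, which almost surely is not `c`, and hence so
does the supremum. -/
lemma measureReal_supRatio_eq (hX : IsPolyaUrn 1 1 1 X μ) (c : ℝ)
    (hmeas : MeasurableSet {ω | ∀ n, redRatio 1 1 1 (fun n => X n ω) n < c}) :
    μ.real {ω | supRatio 1 1 1 (fun n => X n ω) = c} =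
      μ.real {ω | supRatio 1 1 1 (fun n => X n ω) ≤ c} -
        μ.real {ω | ∀ n, redRatio 1 1 1 (fun n => X n ω) n < c} := by
  have hsub : {ω | ∀ n, redRatio 1 1 1 (fun n => X n ω) n < c} ⊆
      {ω | supRatio 1 1 1 (fun n => X n ω) ≤ c} :=
    fun ω hω => (supRatio_le_iff ..).2 fun n => (hω n).le
  rw [← measureReal_sdiff hsub hmeas]
  refine measureReal_congr ?_
  filter_upwards [ae_exists_tendsto_redRatio hX, ae_not_tendsto_redRatio hX c] with ω ⟨L, hL⟩ hc
  refine propext ⟨fun h => ⟨le_of_eq h, fun hlt => ?_⟩, fun h => le_antisymm h.1 ?_⟩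
  · have hLc : L < c := lt_of_le_of_ne (le_of_tendsto' hL fun n => (hlt n).le)
      fun e => hc (e ▸ hL)
    exact (supRatio_lt_of_tendsto hlt hL hLc).ne h
  · obtain ⟨n, hn⟩ := not_forall.1 h.2
    exact (not_lt.1 hn).trans (le_ciSup (bddAbove_range_redRatio ..) n)

end Main

end PolyaUrn

open PolyaUrn in
theorem mainTheorem6 {Ω : Type*} [MeasurableSpace Ω] (μ : Measure Ω) [IsProbabilityMeasure μ]
    (X : ℕ → Ω → Bool) (hX : PolyaUrn.IsPolyaUrn 1 1 1 X μ) (t : ℕ) (ht : 2 ≤ t) :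
    μ.real {ω | PolyaUrn.supRatio 1 1 1 (fun n => X n ω) = ((t : ℝ) - 1) / t} =
        (2 * (t : ℝ) - 3) / t * PolyaUrn.H (1 - 1 / (t : ℝ))
          - ((t : ℝ) - 2) / t * PolyaUrn.H (1 - 2 / (t : ℝ))
          - ((t : ℝ) - 2) / ((t : ℝ) - 1) ∧
      μ.real {ω | PolyaUrn.supRatio 1 1 1 (fun n => X n ω) ≤ ((t : ℝ) - 1) / t} =
        (1 - 1 / (t : ℝ)) * PolyaUrn.H (1 - 1 / (t : ℝ)) := by
  obtain ⟨s, rfl⟩ : ∃ s, t = s + 1 + 1 := ⟨t - 2, by omega⟩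
  have e1 : (((s + 1 + 1 : ℕ) : ℝ) - 1) / (s + 1 + 1 : ℕ) =
      ((s + 1 : ℕ) : ℝ) / ((s + 1 : ℕ) + 1) := by
    push_cast
    ring
  have e2 : 1 - 1 / ((s + 1 + 1 : ℕ) : ℝ) = ((s + 1 : ℕ) : ℝ) / ((s + 1 : ℕ) + 1) := by
    push_cast
    field_simp
    ring
  have hle := measureReal_supRatio_le hX (Nat.succ_pos s)
  rw [e1, e2]
  refine ⟨?_, hle⟩
  have hset : {ω | ∀ n, redRatio 1 1 1 (fun n => X n ω) n < ((s + 1 : ℕ) : ℝ) / ((s + 1 : ℕ) + 1)} =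
      {ω | ∀ n, n < (s + 1 + 1) * numBlack (fun n => X n ω) n + s} := by
    simp only [redRatio_lt_iff]
  rw [measureReal_supRatio_eq hX _ (hset ▸ measurableSet_forall_lt hX.measurable _ _), hle, hset]
  -- For `t = 2` the walk of the strict event starts at zero: the initial proportion `1 / 2` already
  -- attains the threshold, so this event is empty.
  rcases Nat.eq_zero_or_pos s with rfl | hs
  · have hempty : {ω | ∀ n, n < (0 + 1 + 1) * numBlack (fun n => X n ω) n + 0} = ∅ := by
      rw [Set.eq_empty_iff_forall_notMem]
      intro ω hω
      simpa using hω 0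
    rw [hempty, measureReal_empty]
    norm_num
  · have hs' : (0 : ℝ) < s := by exact_mod_cast hs
    have e3 : 1 - 2 / ((s + 1 + 1 : ℕ) : ℝ) = (s : ℝ) / ((s + 1 : ℕ) + 1) := by
      push_cast
      field_simp
      ring
    rw [measureReal_forall_lt hX (s + 1) hs, e3, digamma_eq_H (by positivity),
      digamma_eq_H (by positivity)]
    push_cast
    have h1 : (s : ℝ) + 1 + 1 - 1 ≠ 0 := by
      rw [add_sub_cancel_right]
      positivity
    field_simp
    ring
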